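/- Let $k\in\mathbb N$, write $I$ for the identity of $\mathbb C^{k\times k}$ and $i=\sqrt{-1}$. A state is a positive semidefinite $\rho\in\mathbb C^{k\times k}$ with $\operatorname{tr}\rho=1$. For states $\rho,\sigma$ let $$F_{\max}(\rho,\sigma)=\operatorname{tr}\sqrt{\sqrt\sigma\,\rho\,\sqrt\sigma}$$ be Uhlmann's fidelity and let $$F_{\min}(\rho,\sigma)=\sup\Big\{\sum_{x=1}^n\sqrt{p_xq_x}\;:\;n\in\mathbb N,\ \Phi(p)=\rho,\ \Phi(q)=\sigma\Big\}$$ be the reverse-test fidelity, where $p,q$ range over probability distributions on $\{1,\dots,n\}$ and $\Phi$ over completely positive trace preserving linear maps from the commutative algebra $\mathbb C^n$ (with trace $l\mapsto\sum_x l_x$) to $\mathbb C^{k\times k}$. For $F=F_{\max}$ and $F=F_{\min}$ extend $F$ to all pairs of self-adjoint $X,Y\in\mathbb C^{k\times k}$ by $$F(X,Y)=\begin{cases}\sqrt{\operatorname{tr}X\operatorname{tr}Y}\;F\big(\tfrac{X}{\operatorname{tr}X},\tfrac{Y}{\operatorname{tr}Y}\big),& X,Y\ge0,\ X\ne0,\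 Y\ne0,\\ 0,& X,Y\ge 0,\ X=0\text{ or }Y=0,\\ -\infty,&\text{otherwise.}\end{cases}$$ Let $\mathcal M_{F_{\max}}$ be the set of pairs $(L_0,L_1)$ of self-adjoint $k\times k$ matrices such that $\operatorname{tr}L_0X'+\operatorname{tr}L_1Y'\ge F_{\max}(X',Y')$ for all positive semidefinite $X',Y'$. Then for all self-adjoint $X,Y\in\mathbb C^{k\times k}$, $$F_{\min}(X,Y)=\inf\big\{\operatorname{tr}XL_0+\operatorname{tr}YL_1\;:\;L_0,L_1,A\text{ self-adjoint},\ \big(L_0,(I-iA)^{-1}L_1(I+iA)^{-1}\big)\in\mathcal M_{F_{\max}}\big\},$$ where the infimum is attained if $X$ and $Y$ are positive definite, and $$F_{\min}(X,Y)=\min_{A=A^\dagger}F_{\max}\big(X,(I-iA)Y(I+iA)\big)=\min_{A=A^\dagger}F_{\max}\big((I+iA)X(I-iA),Y\big),$$ where both minima are attained for all self-adjoint $X,Y$. -/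

import Mathlib

open scoped MatrixOrder ComplexOrder

namespace Fidelity

/-- `L_k`: the operators on `ℂ^k`. -/
abbrev Op (k : ℕ) : Type := Matrix (Fin k) (Fin k) ℂ

/-- Classical fidelity `∑ √(p_i q_i)`. -/
noncomputable def classicalFidelity {n : ℕ} (p q : Fin n → ℝ) : ℝ :=
  ∑ i, Real.sqrt (p i * q i)

/-- Complete positivity of a linear map from the commutative algebra `C_n = ℂ^n` to `L_k`.
A positive element of `M_m(C_n)` is a family `B 0, …, B (n-1)` of positive semidefinite `m × m`
matrices, and its image under `id ⊗ Φ` is the block matrix whose block `(a, b)` is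
`Φ (fun x => B x a b)`. -/
def IsCompletelyPositive {n k : ℕ} (Φ : (Fin n → ℂ) →ₗ[ℂ] Op k) : Prop :=
  ∀ (m : ℕ) (B : Fin n → Matrix (Fin m) (Fin m) ℂ), (∀ x, (B x).PosSemidef) →
    (Matrix.of fun a b : Fin m × Fin k => Φ (fun x => B x a.1 b.1) a.2 b.2).PosSemidef

/-- Trace preservation; the trace of `l ∈ C_n` is `∑ x, l x`. -/
def IsTracePreserving {n k : ℕ} (Φ : (Fin n → ℂ) →ₗ[ℂ] Op k) : Prop :=
  ∀ l : Fin n → ℂ, (Φ l).trace = ∑ x, l x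

/-- The values `F^C(p, q)` of all reverse tests of `(ρ, σ)`: probability distributions `p, q` on a
finite set together with a CPTP map sending `p` to `ρ` and `q` to `σ`. -/
def reverseTestValues {k : ℕ} (ρ σ : Op k) : Set ℝ :=
  {c | ∃ (n : ℕ) (p q : Fin n → ℝ) (Φ : (Fin n → ℂ) →ₗ[ℂ] Op k),
    p ∈ stdSimplex ℝ (Fin n) ∧ q ∈ stdSimplex ℝ (Fin n) ∧
    IsCompletelyPositive Φ ∧ IsTracePreserving Φ ∧
    Φ (fun x => (p x : ℂ)) = ρ ∧ Φ (fun x => (q x : ℂ)) = σ ∧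
    c = classicalFidelity p q}

/-- Reverse-test fidelity of states (for states the set is non-empty and bounded by `1`). -/
noncomputable def stateFmin {k : ℕ} (ρ σ : Op k) : ℝ := sSup (reverseTestValues ρ σ)

/-- Uhlmann fidelity of states, `tr √(√σ ρ √σ)`. -/
noncomputable def stateFmax {k : ℕ} (ρ σ : Op k) : ℝ :=
  (CFC.sqrt (CFC.sqrt σ * ρ * CFC.sqrt σ)).trace.re

open Classical in
/-- The extension of a fidelity of states to a functional on pairs of self-adjoint operators:
homogeneous on pairs of positive semidefinite operators, and `-∞` on all other pairs. -/
noncomputable def extend {k : ℕ} (F : Op k → Op k → ℝ) (X Y : Op k) : EReal :=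
  if X.PosSemidef ∧ Y.PosSemidef then
    if X = 0 ∨ Y = 0 then 0
    else ((Real.sqrt (X.trace.re * Y.trace.re) *
      F ((X.trace)⁻¹ • X) ((Y.trace)⁻¹ • Y) : ℝ) : EReal)
  else ⊥

noncomputable def Fmin {k : ℕ} (X Y : Op k) : EReal := extend stateFmin X Y

noncomputable def Fmax {k : ℕ} (X Y : Op k) : EReal := extend stateFmax X Y

/-- The set `M_F` of pairs of self-adjoint operators `(L₀, L₁)` such that
`tr L₀ X + tr L₁ Y ≥ F(X, Y)` for all positive semidefinite `X, Y`. -/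
def supportSet {k : ℕ} (F : Op k → Op k → EReal) : Set (Op k × Op k) :=
  {L | L.1.IsHermitian ∧ L.2.IsHermitian ∧ ∀ X Y : Op k, X.PosSemidef → Y.PosSemidef →
    F X Y ≤ (((L.1 * X).trace.re + (L.2 * Y).trace.re : ℝ) : EReal)}

/-- The values `tr X L₀ + tr Y L₁` over the self-adjoint `L₀, L₁` for which there is a
self-adjoint `A` with `(L₀, (I - iA)⁻¹ L₁ (I + iA)⁻¹) ∈ M_{F_max}`. -/
def deformedDualValues {k : ℕ} (X Y : Op k) : Set EReal :=
  {t | ∃ L₀ L₁ A : Op k, L₀.IsHermitian ∧ L₁.IsHermitian ∧ A.IsHermitian ∧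
    (L₀, (1 - Complex.I • A)⁻¹ * L₁ * (1 + Complex.I • A)⁻¹) ∈ supportSet (Fmax (k := k)) ∧
    t = (((X * L₀).trace.re + (Y * L₁).trace.re : ℝ) : EReal)}

end Fidelity

namespace Fidelity

open Matrix

/-! ### Fidelity as a spectral function of a product, and trace-norm inequalities. -/

section Spectral

variable {m n : Type*} [Fintype m] [DecidableEq m] [Fintype n] [DecidableEq n]

/-! Write `X = M Mᴴ` and `Y = N Nᴴ`. Then `F_max(X, Y)` is the trace norm of `Mᴴ N`, so it dominates
`Re tr Mᴴ N`, with equality when `Mᴴ N` is positive semidefinite. Replacing `N` by `(1 - iA) N`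
preserves this real part when `N Mᴴ` is Hermitian, since `tr A N Mᴴ` is then real. A reverse test
supplies such factors, with `Re tr Mᴴ N` equal to its classical fidelity, so it lies below every
deformed `F_max`.

For equality, diagonalise by congruence: `X = R diag(x) Rᴴ`, `Y = R diag(y) Rᴴ` with `R` invertible.
For states, the normalised columns of `R` give a reverse test with value `congruenceFidelity R x y`.
An explicit `A`, found from a Lyapunov equation, makes `Mᴴ (1 - iA) N` positive semidefinite, so one
deformation attains the same value. Homogeneity removes the normalisation.

The dual formula rests on `F_max(X, Y) ≤ tr L X + tr L⁻¹ Y / 4` for `L > 0`. Testing a dual point on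
the deformed pair gives weak duality; for positive definite pairs the optimal `A` yields an `L` with
equality; singular pairs follow by perturbing `x` and `y`. Outside the positive cone both sides are
`-∞`. -/

lemma exists_unitary_diagonalization {H : Matrix n n ℂ} (hH : H.IsHermitian) :
    ∃ (U : Matrix n n ℂ) (d : n → ℝ), Uᴴ * U = 1 ∧ U * Uᴴ = 1 ∧
      H = U * diagonal (fun i => (d i : ℂ)) * Uᴴ := by
  refine ⟨hH.eigenvectorUnitary, hH.eigenvalues, ?_, ?_, ?_⟩
  · exact Unitary.coe_star_mul_self _
  · exact Unitary.coe_mul_star_self _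
  · conv_lhs => rw [hH.spectral_theorem]
    rw [Unitary.conjStarAlgAut_apply]
    rfl

lemma exists_unitary_diagonalization_nonneg {H : Matrix n n ℂ} (hH : H.PosSemidef) :
    ∃ (U : Matrix n n ℂ) (d : n → ℝ), Uᴴ * U = 1 ∧ U * Uᴴ = 1 ∧ (∀ i, 0 ≤ d i) ∧
      H = U * diagonal (fun i => (d i : ℂ)) * Uᴴ := by
  obtain ⟨U, d, h1, h2, h3⟩ := exists_unitary_diagonalization hH.1
  refine ⟨U, d, h1, h2, fun i => ?_, h3⟩
  have h4 : (diagonal fun i => (d i : ℂ)).PosSemidef := by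
    have h5 := hH.conjTranspose_mul_mul_same U
    rwa [h3, show Uᴴ * (U * diagonal (fun i => (d i : ℂ)) * Uᴴ) * U
      = (Uᴴ * U) * diagonal (fun i => (d i : ℂ)) * (Uᴴ * U) by simp only [Matrix.mul_assoc],
      h1, Matrix.one_mul, Matrix.mul_one] at h5
  simpa using posSemidef_diagonal_iff.1 h4 i

lemma exists_mul_conjTranspose_eq {H : Matrix n n ℂ} (hH : H.PosSemidef) :
    ∃ M : Matrix n n ℂ, M * Mᴴ = H := by
  refine ⟨CFC.sqrt H, ?_⟩
  have h : (CFC.sqrt H).PosSemidef := nonneg_iff_posSemidef.1 (CFC.sqrt_nonneg H)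
  rw [h.1.eq, CFC.sqrt_mul_sqrt_self H hH.nonneg]

/-- The sum of the square roots of the eigenvalues, with algebraic multiplicity. -/
noncomputable def sqrtRootSum (B : Matrix n n ℂ) : ℝ :=
  (B.charpoly.roots.map fun z => Real.sqrt z.re).sum

lemma sum_roots_X_pow_mul (k : ℕ) {p : Polynomial ℂ} (hp : p ≠ 0) :
    ((Polynomial.X ^ k * p).roots.map fun z : ℂ => Real.sqrt z.re).sum
      = (p.roots.map fun z : ℂ => Real.sqrt z.re).sum := by
  rw [Polynomial.roots_mul (mul_ne_zero (pow_ne_zero _ Polynomial.X_ne_zero) hp),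
    Polynomial.roots_X_pow, Multiset.map_add, Multiset.sum_add, Multiset.map_nsmul,
    Multiset.sum_nsmul]
  simp

/-- `A * B` and `B * A` differ only in zero eigenvalues, which contribute nothing. This cyclicity
eliminates operator square roots from `F_max`. -/
lemma sqrtRootSum_mul_comm (A : Matrix m n ℂ) (B : Matrix n m ℂ) :
    sqrtRootSum (A * B) = sqrtRootSum (B * A) := by
  unfold sqrtRootSum
  rw [← sum_roots_X_pow_mul (Fintype.card n) (charpoly_monic (A * B)).ne_zero,
    charpoly_mul_comm', sum_roots_X_pow_mul _ (charpoly_monic (B * A)).ne_zero]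

lemma sqrtRootSum_diagonal (d : n → ℝ) :
    sqrtRootSum (diagonal fun i => (d i : ℂ)) = ∑ i, Real.sqrt (d i) := by
  unfold sqrtRootSum
  rw [charpoly_diagonal, Polynomial.roots_prod _ _
    (by simp [Finset.prod_ne_zero_iff, Polynomial.X_sub_C_ne_zero])]
  simp

lemma sqrtRootSum_conj {U : Matrix n n ℂ} (hU : Uᴴ * U = 1) (D : Matrix n n ℂ) :
    sqrtRootSum (U * D * Uᴴ) = sqrtRootSum D := by
  rw [sqrtRootSum_mul_comm, ← Matrix.mul_assoc, hU, Matrix.one_mul]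

lemma sqrtRootSum_mul_self {P : Matrix n n ℂ} (hP : P.PosSemidef) :
    sqrtRootSum (P * P) = P.trace.re := by
  obtain ⟨U, d, h1, h2, hd, rfl⟩ := exists_unitary_diagonalization_nonneg hP
  rw [show U * diagonal (fun i => (d i : ℂ)) * Uᴴ * (U * diagonal (fun i => (d i : ℂ)) * Uᴴ)
    = U * (diagonal (fun i => (d i : ℂ)) * (Uᴴ * U) * diagonal (fun i => (d i : ℂ))) * Uᴴ by
      simp only [Matrix.mul_assoc], h1, Matrix.mul_one, diagonal_mul_diagonal,
    sqrtRootSum_conj h1, trace_mul_cycle, h1, Matrix.one_mul]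
  have := sqrtRootSum_diagonal (fun i => d i * d i)
  push_cast at this
  rw [this]
  simp [trace, Real.sqrt_mul_self (hd _)]

lemma sqrtRootSum_eq_trace_sqrt {H : Matrix n n ℂ} (hH : H.PosSemidef) :
    (CFC.sqrt H).trace.re = sqrtRootSum H := by
  have h : (CFC.sqrt H).PosSemidef := nonneg_iff_posSemidef.1 (CFC.sqrt_nonneg H)
  rw [← sqrtRootSum_mul_self h, CFC.sqrt_mul_sqrt_self H hH.nonneg]

lemma sqrtRootSum_smul_of_posSemidef {H : Matrix n n ℂ} (hH : H.PosSemidef) {c : ℝ} (hc : 0 ≤ c) :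
    sqrtRootSum ((c : ℂ) • H) = Real.sqrt c * sqrtRootSum H := by
  obtain ⟨U, d, h1, h2, hd, rfl⟩ := exists_unitary_diagonalization_nonneg hH
  rw [← Matrix.smul_mul, ← Matrix.mul_smul, sqrtRootSum_conj h1, sqrtRootSum_conj h1,
    sqrtRootSum_diagonal, ← diagonal_smul]
  have := sqrtRootSum_diagonal (fun i => c * d i)
  push_cast at this
  simp only [Pi.smul_def, smul_eq_mul]
  rw [this, Finset.mul_sum]
  exact Finset.sum_congr rfl fun i _ => Real.sqrt_mul hc _

/-- In an eigenbasis of `Cᴴ * C`, column `i` of `C` has norm `√(d i)`, which bounds its diagonal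
entry. -/
lemma re_trace_le_sqrtRootSum (C : Matrix n n ℂ) : C.trace.re ≤ sqrtRootSum (Cᴴ * C) := by
  obtain ⟨U, d, h1, h2, hd, h3⟩ :=
    exists_unitary_diagonalization_nonneg (posSemidef_conjTranspose_mul_self C)
  rw [h3, sqrtRootSum_conj h1, sqrtRootSum_diagonal]
  set D := Uᴴ * C * U with hD
  have hDD : Dᴴ * D = diagonal fun i => (d i : ℂ) := by
    calc Dᴴ * D = Uᴴ * Cᴴ * (U * Uᴴ) * C * U := by
          simp only [hD, conjTranspose_mul, conjTranspose_conjTranspose, Matrix.mul_assoc]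
      _ = Uᴴ * (Cᴴ * C) * U := by rw [h2, Matrix.mul_one]; simp only [Matrix.mul_assoc]
      _ = (Uᴴ * U) * diagonal (fun i => (d i : ℂ)) * (Uᴴ * U) := by
          rw [h3]; simp only [Matrix.mul_assoc]
      _ = _ := by rw [h1, Matrix.one_mul, Matrix.mul_one]
  have htr : C.trace = D.trace := by
    rw [hD, trace_mul_cycle, h2, Matrix.one_mul]
  rw [htr, trace, Complex.re_sum]
  refine Finset.sum_le_sum fun i _ => ?_
  refine Real.le_sqrt_of_sq_le ?_
  have h4 : d i = ∑ j, ‖D j i‖ ^ 2 := by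
    have := congrFun (congrFun hDD i) i
    rw [diagonal_apply_eq, mul_apply] at this
    have h5 := congrArg Complex.re this
    simp only [conjTranspose_apply, Complex.re_sum, Complex.ofReal_re] at h5
    rw [← h5]
    refine Finset.sum_congr rfl fun j _ => ?_
    rw [Complex.star_def, mul_comm, Complex.mul_conj, Complex.ofReal_re, Complex.normSq_eq_norm_sq]
  rw [h4]
  calc (D.diag i).re ^ 2 ≤ ‖D i i‖ ^ 2 := sq_le_sq' (by
        have := Complex.abs_re_le_norm (D i i); rw [abs_le] at this; exact this.1)
        ((le_abs_self _).trans (Complex.abs_re_le_norm _))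
    _ ≤ _ := Finset.single_le_sum (f := fun j => ‖D j i‖ ^ 2) (fun j _ => sq_nonneg _)
        (Finset.mem_univ i)

/-- An AM-GM inequality: the left side is `tr (M W)ᴴ (N U)` for a polar partial isometry `W` of `Mᴴ
N`. Expand the Hilbert–Schmidt norm of `M W - N U / 2` and use `W Wᴴ ≤ 1`. -/
lemma sqrtRootSum_le_trace_add {X Y : Matrix n n ℂ} (hX : X.PosSemidef) (hY : Y.PosSemidef) :
    sqrtRootSum (X * Y) ≤ X.trace.re + Y.trace.re / 4 := by
  obtain ⟨M, rfl⟩ := exists_mul_conjTranspose_eq hX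
  obtain ⟨N, rfl⟩ := exists_mul_conjTranspose_eq hY
  set C := Mᴴ * N with hC
  obtain ⟨U, d, h1, h2, hd, h3⟩ :=
    exists_unitary_diagonalization_nonneg (posSemidef_conjTranspose_mul_self C)
  have hS : sqrtRootSum (M * Mᴴ * (N * Nᴴ)) = ∑ i, Real.sqrt (d i) := by
    rw [← Matrix.mul_assoc, sqrtRootSum_mul_comm,
      show Nᴴ * (M * Mᴴ * N) = Cᴴ * C by
        simp only [hC, conjTranspose_mul, conjTranspose_conjTranspose, Matrix.mul_assoc],
      h3, sqrtRootSum_conj h1, sqrtRootSum_diagonal]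
  have hDD : (C * U)ᴴ * (C * U) = diagonal fun i => (d i : ℂ) := by
    calc (C * U)ᴴ * (C * U) = Uᴴ * (Cᴴ * C) * U := by
          simp only [conjTranspose_mul, Matrix.mul_assoc]
      _ = (Uᴴ * U) * diagonal (fun i => (d i : ℂ)) * (Uᴴ * U) := by
          rw [h3]; simp only [Matrix.mul_assoc]
      _ = _ := by rw [h1, Matrix.one_mul, Matrix.mul_one]
  -- The convention `0⁻¹ = 0` keeps `W` a partial isometry when `C` is singular.
  set e : n → ℂ := fun i => (((Real.sqrt (d i))⁻¹ : ℝ) : ℂ) with he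
  have hes : star e = e := by ext i; simp [he]
  set W := C * U * diagonal e with hW
  have hWD : Wᴴ * (C * U) = diagonal fun i => (Real.sqrt (d i) : ℂ) := by
    rw [hW, conjTranspose_mul, diagonal_conjTranspose, hes, Matrix.mul_assoc, hDD,
      diagonal_mul_diagonal]
    congr 1; ext i
    simp only [he]
    rw [← Complex.ofReal_mul]; congr 1
    rw [inv_mul_eq_div, Real.div_sqrt]
  have hWW : W * (Wᴴ * W) = W := by
    rw [show Wᴴ * W = Wᴴ * (C * U) * diagonal e by rw [hW, ← Matrix.mul_assoc], hWD,
      diagonal_mul_diagonal, hW, Matrix.mul_assoc, diagonal_mul_diagonal]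
    congr 2; ext i
    simp only [he]
    by_cases h : Real.sqrt (d i) = 0
    · simp [h]
    · rw [← Complex.ofReal_mul, mul_inv_cancel₀ h]; simp
  have hproj : (1 - W * Wᴴ).PosSemidef := by
    have h4 : (1 - W * Wᴴ)ᴴ * (1 - W * Wᴴ) = 1 - W * Wᴴ := by
      rw [conjTranspose_sub, conjTranspose_one, conjTranspose_mul, conjTranspose_conjTranspose,
        Matrix.sub_mul, Matrix.one_mul, Matrix.mul_sub, Matrix.mul_one,
        show W * Wᴴ * (W * Wᴴ) = W * (Wᴴ * W) * Wᴴ by simp only [Matrix.mul_assoc], hWW]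
      simp
    rw [← h4]
    exact posSemidef_conjTranspose_mul_self _
  have hP : (M * Mᴴ).trace.re - (M * W * (M * W)ᴴ).trace.re ≥ 0 := by
    have := (hproj.mul_mul_conjTranspose_same M).trace_nonneg
    rw [Matrix.mul_sub, Matrix.sub_mul, trace_sub, Matrix.mul_one,
      show M * (W * Wᴴ) * Mᴴ = M * W * (M * W)ᴴ by
        simp only [conjTranspose_mul, Matrix.mul_assoc]] at this
    simpa using (Complex.le_def.1 this).1
  have hZ := (posSemidef_conjTranspose_mul_self (M * W - (1 / 2 : ℂ) • (N * U))).trace_nonneg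
  have hZ' := (Complex.le_def.1 hZ).1
  have hc : ((M * W)ᴴ * (N * U)).trace.re = ∑ i, Real.sqrt (d i) := by
    rw [show (M * W)ᴴ * (N * U) = Wᴴ * (C * U) by
      simp only [hC, conjTranspose_mul, Matrix.mul_assoc], hWD]
    simp [trace]
  have hc' : ((N * U)ᴴ * (M * W)).trace.re = ∑ i, Real.sqrt (d i) := by
    rw [← hc, show (N * U)ᴴ * (M * W) = ((M * W)ᴴ * (N * U))ᴴ by simp [conjTranspose_mul],
      trace_conjTranspose]
    simp
  have hN : ((N * U)ᴴ * (N * U)).trace = (N * Nᴴ).trace := by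
    rw [trace_mul_comm, conjTranspose_mul,
      show N * U * (Uᴴ * Nᴴ) = N * (U * Uᴴ) * Nᴴ by simp only [Matrix.mul_assoc], h2,
      Matrix.mul_one]
  rw [hS]
  rw [trace_mul_comm (M * W)] at hP
  simp only [conjTranspose_sub, conjTranspose_smul, Matrix.sub_mul, Matrix.mul_sub,
    Matrix.smul_mul, Matrix.mul_smul, trace_sub, trace_smul, hN, Complex.sub_re,
    smul_eq_mul, Complex.zero_re] at hZ'
  have hh : ∀ z : ℂ, ((1 / 2 : ℂ) * z).re = z.re / 2 := fun z => by
    simp [Complex.mul_re]; ring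
  have hh' : ∀ z : ℂ, (star (1 / 2 : ℂ) * z).re = z.re / 2 := fun z => by
    simp [Complex.mul_re]; ring
  simp only [hh, hh', Complex.sub_re, hc, hc'] at hZ'
  linarith

end Spectral

/-! ### Simultaneous diagonalisation by congruence, and the optimal deformation. -/

section Congruence

variable {n : Type*} [Fintype n] [DecidableEq n]

lemma exists_simultaneous_congruence {X Y : Matrix n n ℂ} (hX : X.PosSemidef)
    (hY : Y.PosSemidef) :
    ∃ (R : Matrix n n ℂ) (x y : n → ℝ), IsUnit R ∧ (∀ i, 0 ≤ x i) ∧ (∀ i, 0 ≤ y i) ∧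
      X = R * diagonal (fun i => (x i : ℂ)) * Rᴴ ∧
      Y = R * diagonal (fun i => (y i : ℂ)) * Rᴴ := by
  obtain ⟨U, s, hU, hU', hs, hS⟩ := exists_unitary_diagonalization_nonneg (hX.add hY)
  -- The value `1` on the kernel of `X + Y` keeps `T` invertible.
  set r : n → ℂ := fun i => if s i = 0 then 1 else (Real.sqrt (s i) : ℂ) with hr
  have hr0 : ∀ i, r i ≠ 0 := fun i => by
    simp only [hr]; split_ifs with h
    · exact one_ne_zero
    · exact_mod_cast (Real.sqrt_pos.2 (lt_of_le_of_ne (hs i) (Ne.symm h))).ne'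
  have hrs : star r = r := by
    ext i; simp only [hr, Pi.star_apply]; split_ifs <;> simp
  have hrs' : star r⁻¹ = r⁻¹ := by
    ext i; have := congrFun hrs i; simp only [Pi.star_apply] at this
    simp [star_inv₀, this]
  set T := U * diagonal r with hT
  set T' := diagonal r⁻¹ * Uᴴ with hT'
  have hrr : diagonal r * diagonal r⁻¹ = 1 := by
    rw [diagonal_mul_diagonal, ← diagonal_one]; congr 1; ext i; simp [hr0 i]
  have hTT : T * T' = 1 := by
    rw [hT, hT', Matrix.mul_assoc, ← Matrix.mul_assoc (diagonal r), hrr, Matrix.one_mul, hU']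
  have hTT' : T' * T = 1 := mul_eq_one_comm.1 hTT
  set Z : Matrix n n ℂ := diagonal (fun i => if s i = 0 then 1 else 0) with hZ
  have hZZ : Z * Z = Z := by
    rw [hZ, diagonal_mul_diagonal]; congr 1; ext i; split_ifs <;> simp
  have hZpos : Z.PosSemidef := by
    refine posSemidef_diagonal_iff.2 fun i => ?_
    split_ifs <;> simp
  set X' := T' * X * T'ᴴ with hX'
  set Y' := T' * Y * T'ᴴ with hY'
  have hXp : X'.PosSemidef := hX.mul_mul_conjTranspose_same T'
  have hYp : Y'.PosSemidef := hY.mul_mul_conjTranspose_same T'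
  have hsum : X' + Y' + Z = 1 := by
    have : X' + Y' = diagonal r⁻¹ * diagonal (fun i => (s i : ℂ)) * diagonal r⁻¹ := by
      calc X' + Y' = T' * (X + Y) * T'ᴴ := by rw [hX', hY', Matrix.mul_add, Matrix.add_mul]
        _ = diagonal r⁻¹ * ((Uᴴ * U) * diagonal (fun i => (s i : ℂ)) * (Uᴴ * U))
            * diagonal r⁻¹ := by
          rw [hS, hT', conjTranspose_mul, diagonal_conjTranspose, hrs', conjTranspose_conjTranspose]
          simp only [Matrix.mul_assoc]
        _ = _ := by rw [hU, Matrix.one_mul, Matrix.mul_one]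
    rw [this, diagonal_mul_diagonal, diagonal_mul_diagonal, hZ, diagonal_add, ← diagonal_one]
    congr 1; ext i
    simp only [hr, Pi.inv_apply]
    split_ifs with h
    · simp [h]
    · have h1 : (Real.sqrt (s i) : ℂ) ≠ 0 := by
        exact_mod_cast (Real.sqrt_pos.2 (lt_of_le_of_ne (hs i) (Ne.symm h))).ne'
      have h2 : (s i : ℂ) = Real.sqrt (s i) * Real.sqrt (s i) := by
        rw [← Complex.ofReal_mul, Real.mul_self_sqrt (hs i)]
      rw [h2]; field_simp; simp
  have hZX : Z * X' = 0 := by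
    have h1 : Z * X' * Zᴴ + Z * Y' * Zᴴ = 0 := by
      have : X' + Y' = 1 - Z := eq_sub_of_add_eq hsum
      rw [← Matrix.add_mul, ← Matrix.mul_add, this, Matrix.mul_sub, hZZ, Matrix.mul_one, sub_self,
        Matrix.zero_mul]
    have h2 := ((add_eq_zero_iff_of_nonneg (hXp.mul_mul_conjTranspose_same Z).nonneg
      (hYp.mul_mul_conjTranspose_same Z).nonneg).1 h1).1
    obtain ⟨M, hM⟩ := exists_mul_conjTranspose_eq hXp
    rw [← hM, show Z * (M * Mᴴ) * Zᴴ = Z * M * (Z * M)ᴴ by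
      simp only [conjTranspose_mul, Matrix.mul_assoc], self_mul_conjTranspose_eq_zero] at h2
    rw [← hM, ← Matrix.mul_assoc, h2, Matrix.zero_mul]
  have hXZ : X' * Z = 0 := by
    have := congrArg conjTranspose hZX
    rwa [conjTranspose_mul, hXp.1.eq, hZpos.1.eq, conjTranspose_zero] at this
  -- As `X' Z = 0`, the absolute value of `X' - Z` is `X' + Z`. One eigenbasis thus diagonalises
  -- `X'`, `Z` and `Y' = 1 - (X' + Z)`.
  obtain ⟨V, h, hV, hV', hH⟩ := exists_unitary_diagonalization (hXp.1.sub hZpos.1)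
  have hconj : ∀ d e : n → ℂ, V * diagonal d * Vᴴ * (V * diagonal e * Vᴴ)
      = V * diagonal (fun i => d i * e i) * Vᴴ := fun d e => by
    rw [← diagonal_mul_diagonal]
    calc _ = V * diagonal d * (Vᴴ * V) * diagonal e * Vᴴ := by simp only [Matrix.mul_assoc]
      _ = _ := by rw [hV, Matrix.mul_one]; simp only [Matrix.mul_assoc]
  have habs : X' + Z = V * diagonal (fun i => ((|h i| : ℝ) : ℂ)) * Vᴴ := by
    have h1 : (X' + Z) * (X' + Z) = (X' - Z) * (X' - Z) := by
      simp only [Matrix.add_mul, Matrix.mul_add, Matrix.sub_mul, Matrix.mul_sub, hXZ, hZX]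
      simp
    have hpos : (V * diagonal (fun i => ((|h i| : ℝ) : ℂ)) * Vᴴ).PosSemidef := by
      refine PosSemidef.mul_mul_conjTranspose_same (posSemidef_diagonal_iff.2 fun i => ?_) V
      exact_mod_cast abs_nonneg _
    rw [← CFC.sqrt_mul_self (X' + Z) (hXp.add hZpos).nonneg, h1, hH, hconj]
    refine CFC.sqrt_unique ?_ hpos.nonneg
    rw [hconj]
    congr 3; ext i
    rw [← Complex.ofReal_mul, ← Complex.ofReal_mul, abs_mul_abs_self]
  have hXd : X' = V * diagonal (fun i => (((|h i| + h i) / 2 : ℝ) : ℂ)) * Vᴴ := by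
    have h1 : X' = (1 / 2 : ℂ) • ((X' + Z) + (X' - Z)) := by
      rw [show (X' + Z) + (X' - Z) = (2 : ℂ) • X' by rw [two_smul]; abel, smul_smul]; norm_num
    rw [h1, habs, hH, ← Matrix.add_mul, ← Matrix.mul_add, diagonal_add, ← Matrix.smul_mul,
      ← Matrix.mul_smul, ← diagonal_smul]
    congr 3; ext i
    simp only [Pi.smul_apply, smul_eq_mul]; push_cast; ring
  have hYd : Y' = V * diagonal (fun i => ((1 - |h i| : ℝ) : ℂ)) * Vᴴ := by
    have h1 : Y' = 1 - (X' + Z) := by rw [← hsum]; abel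
    have h2 : (1 : Matrix n n ℂ) = V * diagonal (fun _ => 1) * Vᴴ := by
      rw [diagonal_one, Matrix.mul_one, hV']
    rw [h1, habs, h2, ← Matrix.sub_mul, ← Matrix.mul_sub, diagonal_sub]
    congr 3; ext i; push_cast; rfl
  have hback : ∀ W : Matrix n n ℂ, T * (T' * W * T'ᴴ) * Tᴴ = W := fun W => by
    calc _ = (T * T') * W * (T * T')ᴴ := by simp only [conjTranspose_mul, Matrix.mul_assoc]
      _ = W := by rw [hTT, conjTranspose_one, Matrix.one_mul, Matrix.mul_one]
  refine ⟨T * V, fun i => (|h i| + h i) / 2, fun i => 1 - |h i|, ?_, ?_, ?_, ?_, ?_⟩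
  · exact (IsUnit.of_mul_eq_one _ hTT).mul (IsUnit.of_mul_eq_one _ hV')
  · intro i; linarith [neg_abs_le (h i)]
  · have h1 := hYp.conjTranspose_mul_mul_same V
    rw [hYd, show ∀ D, Vᴴ * (V * D * Vᴴ) * V = (Vᴴ * V) * D * (Vᴴ * V) by
      intro D; simp only [Matrix.mul_assoc], hV, Matrix.one_mul, Matrix.mul_one,
      posSemidef_diagonal_iff] at h1
    intro i; exact_mod_cast h1 i
  · conv_lhs => rw [← hback X, ← hX', hXd]
    simp only [conjTranspose_mul, Matrix.mul_assoc]
  · conv_lhs => rw [← hback Y, ← hY', hYd]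
    simp only [conjTranspose_mul, Matrix.mul_assoc]

/-- The matrix `P` solves `D P + P D = 2 G` with `D = diag(c)`. In an eigenbasis of `P` the diagonal
reads `2 d i * (Uᴴ D U) i i ≥ 0` with positive second factor, so each `d i ≥ 0`. -/
lemma posSemidef_lyapunov {G : Matrix n n ℂ} (hG : G.PosSemidef) {c : n → ℝ}
    (hc : ∀ i, 0 < c i) :
    (of fun i j => 2 * G i j / ((c i : ℂ) + c j)).PosSemidef := by
  set P : Matrix n n ℂ := of fun i j => 2 * G i j / ((c i : ℂ) + c j) with hP
  have hPH : P.IsHermitian := by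
    ext i j
    have := congrFun (congrFun hG.1 i) j
    rw [conjTranspose_apply] at this
    simp only [conjTranspose_apply, hP, of_apply, star_div₀, star_mul', this, star_add]
    simp [add_comm]
  set D : Matrix n n ℂ := diagonal fun i => (c i : ℂ) with hD
  have hly : D * P + P * D = (2 : ℂ) • G := by
    ext i j
    have hne : (c i : ℂ) + c j ≠ 0 := by exact_mod_cast (add_pos (hc i) (hc j)).ne'
    simp only [hD, hP, Matrix.add_apply, diagonal_mul, mul_diagonal, of_apply, Matrix.smul_apply, smul_eq_mul]
    field_simp
  have hDpos : D.PosDef := posDef_diagonal_iff.2 fun i => by exact_mod_cast hc i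
  obtain ⟨U, d, h1, h2, h3⟩ := exists_unitary_diagonalization hPH
  have hUD : (Uᴴ * D * U).PosDef :=
    hDpos.conjTranspose_mul_mul_same
      (mulVec_injective_of_isUnit (IsUnit.of_mul_eq_one _ h2))
  have hUP : P * U = U * diagonal fun i => (d i : ℂ) := by
    rw [h3, Matrix.mul_assoc, h1, Matrix.mul_one]
  have hUP' : Uᴴ * P = (diagonal fun i => (d i : ℂ)) * Uᴴ := by
    rw [h3, ← Matrix.mul_assoc, ← Matrix.mul_assoc, h1, Matrix.one_mul]
  have hkey : Uᴴ * ((2 : ℂ) • G) * U = Uᴴ * D * U * (diagonal fun i => (d i : ℂ))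
      + (diagonal fun i => (d i : ℂ)) * (Uᴴ * D * U) := by
    rw [← hly, Matrix.mul_add, Matrix.add_mul]
    congr 1
    · rw [Matrix.mul_assoc, Matrix.mul_assoc, hUP]; simp only [Matrix.mul_assoc]
    · rw [← Matrix.mul_assoc, hUP']; simp only [Matrix.mul_assoc]
  have hd : ∀ i, 0 ≤ d i := fun i => by
    have h4 : 0 ≤ (Uᴴ * ((2 : ℂ) • G) * U) i i :=
      ((hG.smul (by norm_num : (0 : ℂ) ≤ 2)).conjTranspose_mul_mul_same U).diag_nonneg
    have h5 : 0 < (Uᴴ * D * U) i i := hUD.diag_pos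
    rw [hkey, Matrix.add_apply, mul_diagonal, diagonal_mul] at h4
    have h6 := (Complex.lt_def.1 h5)
    have h7 := (Complex.le_def.1 h4).1
    simp only [Complex.add_re, Complex.mul_re, Complex.ofReal_re, Complex.ofReal_im,
      Complex.zero_re, mul_zero, zero_mul, sub_zero] at h6 h7
    by_contra hlt
    push Not at hlt
    nlinarith [mul_pos_of_neg_of_neg hlt (neg_lt_zero.2 h6.1)]
  rw [h3]
  exact PosSemidef.mul_mul_conjTranspose_same
    (posSemidef_diagonal_iff.2 fun i => by exact_mod_cast hd i) U

/-- Pulling `A` back through `R` turns the product into `diag(a) (G - iB) diag(b)`. The matrix `B`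
is chosen so that this is a diagonal congruence of a Lyapunov solution with coefficients `a i / b
i`. -/
lemma exists_hermitian_posSemidef {R : Matrix n n ℂ} (hR : IsUnit R) {a b : n → ℝ}
    (ha : ∀ i, 0 ≤ a i) (hb : ∀ i, 0 ≤ b i) :
    ∃ A : Matrix n n ℂ, A.IsHermitian ∧
      ((R * diagonal (fun i => (a i : ℂ)))ᴴ * ((1 - Complex.I • A) *
        (R * diagonal (fun i => (b i : ℂ))))).PosSemidef := by
  set G := Rᴴ * R with hG
  have hGpos : G.PosSemidef := posSemidef_conjTranspose_mul_self R
  have hGs : ∀ i j, star (G j i) = G i j := fun i j => by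
    rw [← conjTranspose_apply, hGpos.1.eq]
  -- Antisymmetry of `t` makes `B` Hermitian; when the denominator is nonzero, `1 - t i j = 2 a_j
  -- b_i / (a_i b_j + a_j b_i)`, which symmetrises `a_i (1 - t i j) b_j`.
  set t : n → n → ℝ := fun i j => (a i * b j - a j * b i) / (a i * b j + a j * b i) with ht
  set B : Matrix n n ℂ := of fun i j => -Complex.I * G i j * t i j with hB
  have hBH : B.IsHermitian := by
    ext i j
    have htt : t j i = - t i j := by
      simp only [ht]; rw [← neg_div, neg_sub, add_comm]
    rw [conjTranspose_apply, hB, of_apply, of_apply, star_mul', star_mul', hGs, htt]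
    simp
  have hdet : IsUnit R.det := (isUnit_iff_isUnit_det R).1 hR
  have hRR : R⁻¹ * R = 1 := nonsing_inv_mul R hdet
  have hRR' : Rᴴ * R⁻¹ᴴ = 1 := by rw [← conjTranspose_mul, hRR, conjTranspose_one]
  refine ⟨R⁻¹ᴴ * B * R⁻¹, ?_, ?_⟩
  · exact isHermitian_conjTranspose_mul_mul _ hBH
  have hK : Rᴴ * ((1 - Complex.I • (R⁻¹ᴴ * B * R⁻¹)) * R) = G - Complex.I • B := by
    rw [Matrix.sub_mul, Matrix.mul_sub, Matrix.one_mul, Matrix.smul_mul, Matrix.mul_smul,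
      show Rᴴ * (R⁻¹ᴴ * B * R⁻¹ * R) = (Rᴴ * R⁻¹ᴴ) * B * (R⁻¹ * R) by
        simp only [Matrix.mul_assoc], hRR, hRR', Matrix.one_mul, Matrix.mul_one]
  -- The default `1` only keeps `c` positive: `g` vanishes at those indices.
  set c : n → ℝ := fun i => if a i = 0 ∨ b i = 0 then 1 else a i / b i with hc
  have hcpos : ∀ i, 0 < c i := fun i => by
    simp only [hc]; split_ifs with h
    · exact one_pos
    · push Not at h
      exact div_pos (lt_of_le_of_ne (ha i) h.1.symm) (lt_of_le_of_ne (hb i) h.2.symm)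
  set g : n → ℝ := fun i => if b i = 0 then 0 else a i with hg
  have hfin := (posSemidef_lyapunov hGpos hcpos).mul_mul_conjTranspose_same
    (diagonal fun i => (g i : ℂ))
  convert hfin using 1
  rw [conjTranspose_mul, show (diagonal fun i => (a i : ℂ))ᴴ * Rᴴ *
      ((1 - Complex.I • (R⁻¹ᴴ * B * R⁻¹)) * (R * diagonal fun i => (b i : ℂ)))
      = (diagonal fun i => (a i : ℂ))ᴴ * (Rᴴ * ((1 - Complex.I • (R⁻¹ᴴ * B * R⁻¹)) * R))
        * diagonal fun i => (b i : ℂ) by simp only [Matrix.mul_assoc], hK]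
  ext i j
  simp only [diagonal_conjTranspose, mul_diagonal, diagonal_mul, Matrix.sub_apply, Matrix.smul_apply, hB,
    of_apply, Pi.star_apply, Complex.star_def, Complex.conj_ofReal, smul_eq_mul]
  have h1 : Complex.I * (-Complex.I * G i j * (t i j : ℂ)) = G i j * t i j := by
    linear_combination (-G i j * (t i j : ℂ)) * Complex.I_mul_I
  rw [h1]
  have h2 : a i * (1 - t i j) * b j = g i * (2 / (c i + c j)) * g j := by
    simp only [ht, hc, hg]
    by_cases hai : a i = 0
    · simp [hai]
    by_cases hbj : b j = 0
    · simp [hbj]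
    have hai' := lt_of_le_of_ne (ha i) (Ne.symm hai)
    have hbj' := lt_of_le_of_ne (hb j) (Ne.symm hbj)
    have hden : a i * b j + a j * b i ≠ 0 :=
      (add_pos_of_pos_of_nonneg (mul_pos hai' hbj') (mul_nonneg (ha j) (hb i))).ne'
    by_cases haj : a j = 0
    · simp [haj, hai, hbj]
    by_cases hbi : b i = 0
    · simp [hai, hbj, hbi]
    simp only [hai, hbj, haj, hbi, or_self, if_false]
    have hden' : a i / b i + a j / b j ≠ 0 := by
      rw [div_add_div _ _ hbi hbj]
      refine div_ne_zero ?_ (mul_ne_zero hbi hbj)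
      rwa [mul_comm (b i)]
    rw [one_sub_div hden, show a i / b i + a j / b j = (a i * b j + a j * b i) / (b i * b j) by
      field_simp]
    field_simp
    ring
  have h3 := congrArg (fun z : ℝ => (z : ℂ)) h2
  push_cast at h3
  linear_combination G i j * h3

end Congruence

/-! ### Uhlmann fidelity through factorisations, and its behaviour under deformation. -/

section StateFidelity

variable {k : ℕ} {m : Type*} [Fintype m]

lemma stateFmax_eq_sqrtRootSum {X Y : Op k} (hX : X.PosSemidef) (hY : Y.PosSemidef) :
    stateFmax X Y = sqrtRootSum (X * Y) := by
  have h : (CFC.sqrt Y).PosSemidef := nonneg_iff_posSemidef.1 (CFC.sqrt_nonneg Y)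
  have h1 : (CFC.sqrt Y * X * CFC.sqrt Y).PosSemidef := by
    have := hX.mul_mul_conjTranspose_same (CFC.sqrt Y)
    rwa [h.1.eq] at this
  unfold stateFmax
  rw [sqrtRootSum_eq_trace_sqrt h1, sqrtRootSum_mul_comm, ← Matrix.mul_assoc,
    CFC.sqrt_mul_sqrt_self Y hY.nonneg, sqrtRootSum_mul_comm]

lemma stateFmax_mul_conjTranspose [DecidableEq m] (M N : Matrix (Fin k) m ℂ) :
    stateFmax (M * Mᴴ) (N * Nᴴ) = sqrtRootSum ((Mᴴ * N)ᴴ * (Mᴴ * N)) := by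
  rw [stateFmax_eq_sqrtRootSum (posSemidef_self_mul_conjTranspose M)
    (posSemidef_self_mul_conjTranspose N), ← Matrix.mul_assoc, sqrtRootSum_mul_comm,
    conjTranspose_mul, conjTranspose_conjTranspose]
  simp only [Matrix.mul_assoc]

lemma re_trace_le_stateFmax [DecidableEq m] (M N : Matrix (Fin k) m ℂ) :
    (Mᴴ * N).trace.re ≤ stateFmax (M * Mᴴ) (N * Nᴴ) := by
  rw [stateFmax_mul_conjTranspose]
  exact re_trace_le_sqrtRootSum _

lemma stateFmax_eq_re_trace [DecidableEq m] {M N : Matrix (Fin k) m ℂ} (h : (Mᴴ * N).PosSemidef) :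
    stateFmax (M * Mᴴ) (N * Nᴴ) = (Mᴴ * N).trace.re := by
  rw [stateFmax_mul_conjTranspose, h.1.eq, sqrtRootSum_mul_self h]

lemma stateFmax_smul_smul {X Y : Op k} (hX : X.PosSemidef) (hY : Y.PosSemidef) {a b : ℝ}
    (ha : 0 ≤ a) (hb : 0 ≤ b) :
    stateFmax ((a : ℂ) • X) ((b : ℂ) • Y) = Real.sqrt (a * b) * stateFmax X Y := by
  rw [stateFmax_eq_sqrtRootSum (hX.smul (by exact_mod_cast ha)) (hY.smul (by exact_mod_cast hb)),
    stateFmax_eq_sqrtRootSum hX hY]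
  obtain ⟨M, rfl⟩ := exists_mul_conjTranspose_eq hX
  have h : (Mᴴ * Y * M).PosSemidef := hY.conjTranspose_mul_mul_same M
  rw [Matrix.smul_mul, Matrix.mul_smul, smul_smul, ← Complex.ofReal_mul, Matrix.mul_assoc M,
    ← Matrix.mul_smul, sqrtRootSum_mul_comm, Matrix.smul_mul,
    sqrtRootSum_smul_of_posSemidef h (mul_nonneg ha hb), sqrtRootSum_mul_comm M]

/-- With `L = B Bᴴ`, apply the AM-GM bound to `Bᴴ X B` and `B⁻¹ Y B⁻¹ᴴ`; the factors `B` cancel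
cyclically in the product. -/
lemma stateFmax_le {X Y L : Op k} (hX : X.PosSemidef) (hY : Y.PosSemidef) (hL : L.PosDef) :
    stateFmax X Y ≤ (L * X).trace.re + (L⁻¹ * Y).trace.re / 4 := by
  obtain ⟨B, rfl⟩ := exists_mul_conjTranspose_eq hL.posSemidef
  have hB : IsUnit B.det := by
    have := (isUnit_iff_isUnit_det _).1 hL.isUnit
    rw [det_mul] at this
    exact isUnit_of_mul_isUnit_left this
  have hB' : B⁻¹ * B = 1 := nonsing_inv_mul B hB
  have hB'' : B * B⁻¹ = 1 := mul_nonsing_inv B hB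
  have h := sqrtRootSum_le_trace_add (hX.conjTranspose_mul_mul_same B)
    (hY.mul_mul_conjTranspose_same B⁻¹)
  rw [show Bᴴ * X * B * (B⁻¹ * Y * B⁻¹ᴴ) = Bᴴ * X * (B * B⁻¹) * Y * B⁻¹ᴴ by
      simp only [Matrix.mul_assoc], hB'', Matrix.mul_one, sqrtRootSum_mul_comm,
    show B⁻¹ᴴ * (Bᴴ * X * Y) = (B * B⁻¹)ᴴ * (X * Y) by
      simp only [conjTranspose_mul, Matrix.mul_assoc], hB'', conjTranspose_one, Matrix.one_mul,
    trace_mul_cycle, trace_mul_cycle B⁻¹, conjTranspose_nonsing_inv, ← Matrix.mul_inv_rev] at h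
  rwa [stateFmax_eq_sqrtRootSum hX hY]

lemma conjTranspose_one_sub {A : Op k} (hA : A.IsHermitian) :
    (1 - Complex.I • A)ᴴ = 1 + Complex.I • A := by
  simp [conjTranspose_sub, conjTranspose_smul, hA.eq]

lemma conjTranspose_one_add {A : Op k} (hA : A.IsHermitian) :
    (1 + Complex.I • A)ᴴ = 1 - Complex.I • A := by
  simp [conjTranspose_add, conjTranspose_smul, hA.eq, sub_eq_add_neg]

lemma posSemidef_deform {Y A : Op k} (hY : Y.PosSemidef) (hA : A.IsHermitian) :
    ((1 - Complex.I • A) * Y * (1 + Complex.I • A)).PosSemidef := by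
  rw [← conjTranspose_one_sub hA]
  exact hY.mul_mul_conjTranspose_same _

lemma posSemidef_deform' {Y A : Op k} (hY : Y.PosSemidef) (hA : A.IsHermitian) :
    ((1 + Complex.I • A) * Y * (1 - Complex.I • A)).PosSemidef := by
  rw [← conjTranspose_one_add hA]
  exact hY.mul_mul_conjTranspose_same _

lemma stateFmax_deform_comm {X Y A : Op k} (hX : X.PosSemidef) (hY : Y.PosSemidef)
    (hA : A.IsHermitian) :
    stateFmax ((1 + Complex.I • A) * X * (1 - Complex.I • A)) Y
      = stateFmax X ((1 - Complex.I • A) * Y * (1 + Complex.I • A)) := by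
  rw [stateFmax_eq_sqrtRootSum (posSemidef_deform' hX hA) hY,
    stateFmax_eq_sqrtRootSum hX (posSemidef_deform hY hA), Matrix.mul_assoc, Matrix.mul_assoc,
    sqrtRootSum_mul_comm]
  simp only [Matrix.mul_assoc]

/-- `tr A (N Mᴴ)` is real for Hermitian factors, so the term carrying `i` is purely imaginary. -/
lemma re_trace_mul_deform {M N : Matrix (Fin k) m ℂ} {A : Op k} (hA : A.IsHermitian)
    (h : (N * Mᴴ).IsHermitian) :
    (Mᴴ * ((1 - Complex.I • A) * N)).trace.re = (Mᴴ * N).trace.re := by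
  have h2 : (Mᴴ * (A * N)).trace.im = 0 := by
    rw [trace_mul_comm, Matrix.mul_assoc]
    refine Complex.conj_eq_iff_im.1 ?_
    change star _ = _
    rw [← trace_conjTranspose, conjTranspose_mul, h.eq, hA.eq, trace_mul_comm]
  rw [Matrix.sub_mul, Matrix.mul_sub, Matrix.one_mul, Matrix.smul_mul, Matrix.mul_smul, trace_sub,
    trace_smul, Complex.sub_re, smul_eq_mul, Complex.mul_re, h2]
  simp

lemma re_trace_le_stateFmax_deform [DecidableEq m] {M N : Matrix (Fin k) m ℂ} {A : Op k} (hA : A.IsHermitian)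
    (h : (N * Mᴴ).IsHermitian) :
    (Mᴴ * N).trace.re
      ≤ stateFmax (M * Mᴴ) ((1 - Complex.I • A) * (N * Nᴴ) * (1 + Complex.I • A)) := by
  have h1 := re_trace_le_stateFmax M ((1 - Complex.I • A) * N)
  rw [conjTranspose_mul, conjTranspose_one_sub hA,
    show (1 - Complex.I • A) * N * (Nᴴ * (1 + Complex.I • A))
      = (1 - Complex.I • A) * (N * Nᴴ) * (1 + Complex.I • A) by simp only [Matrix.mul_assoc]] at h1
  rwa [re_trace_mul_deform hA h] at h1

end StateFidelity

/-! ### The common value attained on a congruence pair. -/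

section CongruenceFidelity

variable {k : ℕ}

/-- The fidelity of the pair `R diag(x) Rᴴ`, `R diag(y) Rᴴ` computed from the weighted columns
of `R`. -/
noncomputable def congruenceFidelity (R : Op k) (x y : Fin k → ℝ) : ℝ :=
  ∑ j, Real.sqrt (x j * y j) * ((Rᴴ * R) j j).re

/-- The operator `R diag(x) Rᴴ`. -/
noncomputable def congruence (R : Op k) (x : Fin k → ℝ) : Op k :=
  R * diagonal (fun i => (x i : ℂ)) * Rᴴ

lemma congruence_posSemidef (R : Op k) {x : Fin k → ℝ} (hx : ∀ i, 0 ≤ x i) :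
    (congruence R x).PosSemidef :=
  PosSemidef.mul_mul_conjTranspose_same
    (posSemidef_diagonal_iff.2 fun i => by exact_mod_cast hx i) R

lemma congruence_isHermitian (R : Op k) (x : Fin k → ℝ) : (congruence R x).IsHermitian := by
  refine isHermitian_mul_mul_conjTranspose _ ?_
  ext i j
  by_cases h : i = j
  · subst h; simp
  · simp [h, Ne.symm h]

lemma sqrt_factor_mul (R : Op k) (x y : Fin k → ℝ) :
    (R * diagonal (fun i => (Real.sqrt (x i) : ℂ))) *
      (R * diagonal (fun i => (Real.sqrt (y i) : ℂ)))ᴴ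
        = congruence R (fun i => Real.sqrt (x i) * Real.sqrt (y i)) := by
  have : (diagonal fun i => (Real.sqrt (y i) : ℂ))ᴴ = diagonal fun i => (Real.sqrt (y i) : ℂ) := by
    rw [diagonal_conjTranspose]; congr 1; ext i; simp
  rw [conjTranspose_mul, this, congruence]
  push_cast
  rw [← diagonal_mul_diagonal]
  simp only [Matrix.mul_assoc]

lemma sqrt_factor_mul_self (R : Op k) {x : Fin k → ℝ} (hx : ∀ i, 0 ≤ x i) :
    (R * diagonal (fun i => (Real.sqrt (x i) : ℂ))) *
      (R * diagonal (fun i => (Real.sqrt (x i) : ℂ)))ᴴ = congruence R x := by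
  rw [sqrt_factor_mul]
  congr 1; ext i; exact Real.mul_self_sqrt (hx i)

lemma trace_mul_congruence (R B : Op k) (x : Fin k → ℝ) :
    (B * congruence R x).trace = ∑ j, (x j : ℂ) * (Rᴴ * B * R) j j := by
  rw [congruence, ← Matrix.mul_assoc, trace_mul_comm, ← Matrix.mul_assoc, ← Matrix.mul_assoc,
    trace]
  simp [mul_diagonal, mul_comm]

lemma re_trace_congruence (R : Op k) (x : Fin k → ℝ) :
    (congruence R x).trace.re = ∑ j, x j * ((Rᴴ * R) j j).re := by
  have := trace_mul_congruence R 1 x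
  rw [Matrix.one_mul, Matrix.mul_one] at this
  rw [this, Complex.re_sum]
  simp

lemma re_trace_sqrt_factor (R : Op k) {x y : Fin k → ℝ} (hx : ∀ i, 0 ≤ x i) :
    ((R * diagonal (fun i => (Real.sqrt (x i) : ℂ)))ᴴ *
      (R * diagonal (fun i => (Real.sqrt (y i) : ℂ)))).trace.re = congruenceFidelity R x y := by
  rw [trace_mul_comm, sqrt_factor_mul, re_trace_congruence, congruenceFidelity]
  refine Finset.sum_congr rfl fun j _ => ?_
  rw [Real.sqrt_mul (hx j), mul_comm (Real.sqrt (y j))]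

lemma congruenceFidelity_le_stateFmax (R : Op k) {x y : Fin k → ℝ} (hx : ∀ i, 0 ≤ x i)
    (hy : ∀ i, 0 ≤ y i) {A : Op k} (hA : A.IsHermitian) :
    congruenceFidelity R x y ≤ stateFmax (congruence R x)
      ((1 - Complex.I • A) * congruence R y * (1 + Complex.I • A)) := by
  rw [← re_trace_sqrt_factor R hx, ← sqrt_factor_mul_self R hx, ← sqrt_factor_mul_self R hy]
  refine re_trace_le_stateFmax_deform hA ?_
  rw [sqrt_factor_mul]
  exact congruence_isHermitian _ _

lemma exists_optimal_deformation {R : Op k} (hR : IsUnit R) {x y : Fin k → ℝ}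
    (hx : ∀ i, 0 ≤ x i) (hy : ∀ i, 0 ≤ y i) :
    ∃ A : Op k, A.IsHermitian ∧
      ((R * diagonal (fun i => (Real.sqrt (x i) : ℂ)))ᴴ * ((1 - Complex.I • A) *
        (R * diagonal (fun i => (Real.sqrt (y i) : ℂ))))).PosSemidef ∧
      stateFmax (congruence R x) ((1 - Complex.I • A) * congruence R y * (1 + Complex.I • A))
        = ((R * diagonal (fun i => (Real.sqrt (x i) : ℂ)))ᴴ * ((1 - Complex.I • A) *
        (R * diagonal (fun i => (Real.sqrt (y i) : ℂ))))).trace.re ∧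
      stateFmax (congruence R x) ((1 - Complex.I • A) * congruence R y * (1 + Complex.I • A))
        = congruenceFidelity R x y := by
  obtain ⟨A, hA, hP⟩ := exists_hermitian_posSemidef hR (fun i => Real.sqrt_nonneg (x i))
    (fun i => Real.sqrt_nonneg (y i))
  have h1 := stateFmax_eq_re_trace hP
  rw [conjTranspose_mul (1 - Complex.I • A), conjTranspose_one_sub hA,
    ← Matrix.mul_assoc _ _ (1 + Complex.I • A),
    Matrix.mul_assoc (1 - Complex.I • A) _ (_)ᴴ, sqrt_factor_mul_self R hx,
    sqrt_factor_mul_self R hy] at h1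
  refine ⟨A, hA, hP, h1, ?_⟩
  rw [h1, ← re_trace_sqrt_factor R hx]
  refine re_trace_mul_deform hA ?_
  rw [sqrt_factor_mul]
  exact congruence_isHermitian _ _

end CongruenceFidelity

/-! ### Reverse tests: upper bound and an optimal test. -/

section ReverseTest

variable {k : ℕ}

lemma IsCompletelyPositive.posSemidef_apply_single {n : ℕ} {Φ : (Fin n → ℂ) →ₗ[ℂ] Op k}
    (hΦ : IsCompletelyPositive Φ) (x : Fin n) :
    (Φ fun y => if x = y then 1 else 0).PosSemidef := by
  have h := hΦ 1 (fun y => if x = y then 1 else 0) (fun y => by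
    split_ifs
    · exact PosSemidef.one
    · exact PosSemidef.zero)
  have h1 := h.submatrix (fun a : Fin k => ((0 : Fin 1), a))
  convert h1 using 1
  ext a b
  have hx : (fun y => (if x = y then 1 else 0 : Matrix (Fin 1) (Fin 1) ℂ) 0 0)
      = fun y => if x = y then 1 else 0 := by
    ext y; split_ifs <;> simp
  rw [submatrix_apply, of_apply, hx]

lemma weighted_factor_mul {n : ℕ} (G : Fin n → Op k) (u v : Fin n → ℝ) :
    (of fun (a : Fin k) (i : Fin n × Fin k) => (u i.1 : ℂ) * G i.1 a i.2) *
      (of fun (a : Fin k) (i : Fin n × Fin k) => (v i.1 : ℂ) * G i.1 a i.2)ᴴ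
        = ∑ x, ((u x * v x : ℝ) : ℂ) • (G x * (G x)ᴴ) := by
  ext a b
  simp only [mul_apply, conjTranspose_apply, of_apply, Matrix.sum_apply, Matrix.smul_apply, smul_eq_mul,
    Fintype.sum_prod_type, Finset.mul_sum]
  refine Finset.sum_congr rfl fun x _ => Finset.sum_congr rfl fun c _ => ?_
  simp only [star_mul', Complex.star_def, Complex.conj_ofReal, Complex.ofReal_mul]
  ring

/-- Factor the images of point masses as `G x (G x)ᴴ` and assemble the blocks `√(p x) G x` and `√(q
x) G x` into `M` and `N`. Then `N Mᴴ` is Hermitian and its trace is the classical fidelity. -/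
lemma reverseTestValues_le {ρ σ : Op k} {c : ℝ} (hc : c ∈ reverseTestValues ρ σ) {A : Op k}
    (hA : A.IsHermitian) :
    c ≤ stateFmax ρ ((1 - Complex.I • A) * σ * (1 + Complex.I • A)) := by
  obtain ⟨n, p, q, Φ, hp, hq, hcp, htp, rfl, rfl, rfl⟩ := hc
  choose G hG using fun x => exists_mul_conjTranspose_eq (hcp.posSemidef_apply_single x)
  have hsum : ∀ l : Fin n → ℝ, Φ (fun x => (l x : ℂ)) = ∑ x, (l x : ℂ) • (G x * (G x)ᴴ) := fun l => by
    rw [LinearMap.pi_apply_eq_sum_univ Φ]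
    exact Finset.sum_congr rfl fun x _ => by rw [hG]
  have hself : ∀ l : Fin n → ℝ, (∀ x, 0 ≤ l x) → Φ (fun x => (l x : ℂ))
      = (of fun (a : Fin k) (i : Fin n × Fin k) => (Real.sqrt (l i.1) : ℂ) * G i.1 a i.2) *
        (of fun (a : Fin k) (i : Fin n × Fin k) => (Real.sqrt (l i.1) : ℂ) * G i.1 a i.2)ᴴ := by
    intro l hl
    rw [weighted_factor_mul G (fun x => Real.sqrt (l x)) (fun x => Real.sqrt (l x)), hsum]
    exact Finset.sum_congr rfl fun x _ => by rw [Real.mul_self_sqrt (hl x)]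
  have htr : ∀ x, (G x * (G x)ᴴ).trace = 1 := fun x => by
    rw [hG, htp]; simp
  rw [hself p hp.1, hself q hq.1]
  have hcross := weighted_factor_mul G (fun x => Real.sqrt (q x)) (fun x => Real.sqrt (p x))
  refine le_trans (le_of_eq ?_) (re_trace_le_stateFmax_deform hA ?_)
  · rw [trace_mul_comm, hcross, trace_sum, Complex.re_sum, classicalFidelity]
    refine Finset.sum_congr rfl fun x _ => ?_
    rw [trace_smul, htr, smul_eq_mul, mul_one, Complex.ofReal_re, Real.sqrt_mul (hp.1 x), mul_comm]
  · rw [hcross]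
    refine isSelfAdjoint_sum _ fun x _ => ?_
    exact ((posSemidef_self_mul_conjTranspose (G x)).smul
      (by exact_mod_cast mul_nonneg (Real.sqrt_nonneg _) (Real.sqrt_nonneg _))).1

lemma gram_diag_pos {R : Op k} (hR : IsUnit R) (j : Fin k) : 0 < (Rᴴ * R) j j :=
  (PosDef.conjTranspose_mul_self R (mulVec_injective_of_isUnit hR)).diag_pos

lemma congruenceFidelity_mem_reverseTestValues {R : Op k} (hR : IsUnit R) {x y : Fin k → ℝ}
    (hx : ∀ i, 0 ≤ x i) (hy : ∀ i, 0 ≤ y i) (hx1 : (congruence R x).trace.re = 1)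
    (hy1 : (congruence R y).trace.re = 1) :
    congruenceFidelity R x y ∈ reverseTestValues (congruence R x) (congruence R y) := by
  set w : Fin k → ℝ := fun j => ((Rᴴ * R) j j).re with hw
  have hwpos : ∀ j, 0 < w j := fun j => (Complex.lt_def.1 (gram_diag_pos hR j)).1
  have hwC : ∀ j, (Rᴴ * R) j j = (w j : ℂ) := fun j => by
    refine Complex.ext rfl ?_
    simpa using (Complex.lt_def.1 (gram_diag_pos hR j)).2.symm
  have hw0 : ∀ j, (w j : ℂ) ≠ 0 := fun j => by exact_mod_cast (hwpos j).ne'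
  -- Point mass `j` goes to the normalised projector onto column `j` of `R`, whose squared norm is
  -- `w j`.
  let Φ : (Fin k → ℂ) →ₗ[ℂ] Op k :=
    { toFun := fun l => R * diagonal (fun j => l j / w j) * Rᴴ
      map_add' := fun l l' => by
        rw [← Matrix.add_mul, ← Matrix.mul_add, diagonal_add]
        congr 3; ext j; simp [add_div]
      map_smul' := fun c l => by
        rw [RingHom.id_apply, ← Matrix.smul_mul, ← Matrix.mul_smul, ← diagonal_smul]
        congr 3; ext j; simp [mul_div_assoc] }
  have hΦ : ∀ l, Φ l = R * diagonal (fun j => l j / w j) * Rᴴ := fun _ => rfl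
  have hΦw : ∀ z : Fin k → ℝ, Φ (fun j => ((z j * w j : ℝ) : ℂ)) = congruence R z := fun z => by
    rw [hΦ, congruence]
    congr 3; ext j; push_cast; exact mul_div_cancel_right₀ _ (hw0 j)
  refine ⟨k, fun j => x j * w j, fun j => y j * w j, Φ, ⟨fun j => mul_nonneg (hx j) (hwpos j).le, ?_⟩,
    ⟨fun j => mul_nonneg (hy j) (hwpos j).le, ?_⟩, ?_, ?_, hΦw x, hΦw y, ?_⟩
  · rw [← hx1, re_trace_congruence]
  · rw [← hy1, re_trace_congruence]
  · intro m B hB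
    -- The output block matrix is a positive combination of `B j` tensored with rank-one matrices.
    have h : (∑ j, ((w j : ℂ)⁻¹) •
        Matrix.kronecker (B j) (vecMulVec (fun a => R a j) (star fun a => R a j))).PosSemidef := by
      refine posSemidef_sum _ fun j _ => ?_
      refine ((hB j).kronecker (posSemidef_vecMulVec_self_star _)).smul ?_
      exact_mod_cast (inv_pos.2 (hwpos j)).le
    convert h using 1
    ext a b
    rw [of_apply, hΦ, mul_apply]
    simp only [mul_diagonal, conjTranspose_apply, Matrix.sum_apply,
      Matrix.smul_apply, kronecker, kroneckerMap_apply, vecMulVec_apply, Pi.star_apply, smul_eq_mul]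
    refine Finset.sum_congr rfl fun j _ => ?_
    ring
  · intro l
    rw [hΦ, trace_mul_cycle, trace]
    refine Finset.sum_congr rfl fun j _ => ?_
    rw [diag_apply, mul_diagonal, hwC, mul_div_cancel₀ _ (hw0 j)]
  · rw [classicalFidelity, congruenceFidelity]
    refine Finset.sum_congr rfl fun j _ => ?_
    rw [show x j * w j * (y j * w j) = x j * y j * (w j * w j) by ring,
      Real.sqrt_mul (mul_nonneg (hx j) (hy j)), Real.sqrt_mul_self (hwpos j).le]

lemma stateFmin_congruence {R : Op k} (hR : IsUnit R) {x y : Fin k → ℝ}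
    (hx : ∀ i, 0 ≤ x i) (hy : ∀ i, 0 ≤ y i) (hx1 : (congruence R x).trace.re = 1)
    (hy1 : (congruence R y).trace.re = 1) :
    stateFmin (congruence R x) (congruence R y) = congruenceFidelity R x y := by
  obtain ⟨A, hA, -, -, h⟩ := exists_optimal_deformation hR hx hy
  exact IsGreatest.csSup_eq ⟨congruenceFidelity_mem_reverseTestValues hR hx hy hx1 hy1,
    fun c hc => h ▸ reverseTestValues_le hc hA⟩

end ReverseTest

/-! ### Homogeneous extension to unnormalised operators. -/

section Extension

variable {k : ℕ}

lemma extend_of_not {F : Op k → Op k → ℝ} {X Y : Op k}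
    (h : ¬ (X.PosSemidef ∧ Y.PosSemidef)) : extend F X Y = ⊥ := if_neg h

lemma trace_eq_ofReal {X : Op k} (hX : X.PosSemidef) : X.trace = (X.trace.re : ℂ) := by
  refine Complex.ext rfl ?_
  simpa using (Complex.le_def.1 hX.trace_nonneg).2.symm

lemma re_trace_pos {X : Op k} (hX : X.PosSemidef) (h : X ≠ 0) : 0 < X.trace.re := by
  refine lt_of_le_of_ne (Complex.le_def.1 hX.trace_nonneg).1 fun h0 => h ?_
  rw [← hX.trace_eq_zero_iff, trace_eq_ofReal hX, ← h0]; simp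

lemma Fmax_eq_stateFmax {X Y : Op k} (hX : X.PosSemidef) (hY : Y.PosSemidef) :
    Fmax X Y = (stateFmax X Y : EReal) := by
  unfold Fmax extend
  rw [if_pos ⟨hX, hY⟩]
  split_ifs with h
  · rcases h with rfl | rfl
    · simp [stateFmax]
    · simp [stateFmax]
  · push Not at h
    have hx := re_trace_pos hX h.1
    have hy := re_trace_pos hY h.2
    rw [trace_eq_ofReal hX, trace_eq_ofReal hY, ← Complex.ofReal_inv, ← Complex.ofReal_inv,
      stateFmax_smul_smul hX hY (inv_pos.2 hx).le (inv_pos.2 hy).le, ← mul_assoc,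
      Complex.ofReal_re, Complex.ofReal_re, ← Real.sqrt_mul (mul_pos hx hy).le,
      show X.trace.re * Y.trace.re * (X.trace.re⁻¹ * Y.trace.re⁻¹) = 1 by field_simp]
    simp

lemma congruence_smul (R : Op k) (x : Fin k → ℝ) (c : ℝ) :
    (c : ℂ) • congruence R x = congruence R (fun i => c * x i) := by
  rw [congruence, congruence, ← Matrix.smul_mul, ← Matrix.mul_smul, ← diagonal_smul]
  congr 3; ext i; simp

lemma congruenceFidelity_mul_mul (R : Op k) {x y : Fin k → ℝ} {a b : ℝ} (hab : 0 ≤ a * b) :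
    congruenceFidelity R (fun i => a * x i) (fun i => b * y i)
      = Real.sqrt (a * b) * congruenceFidelity R x y := by
  rw [congruenceFidelity, congruenceFidelity, Finset.mul_sum]
  refine Finset.sum_congr rfl fun j _ => ?_
  rw [show a * x j * (b * y j) = a * b * (x j * y j) by ring, Real.sqrt_mul hab, mul_assoc]

lemma eq_zero_of_congruence_eq_zero {R : Op k} (hR : IsUnit R) {x : Fin k → ℝ}
    (h : congruence R x = 0) : x = 0 := by
  have hdet := (isUnit_iff_isUnit_det R).1 hR
  have h1 : diagonal (fun i => (x i : ℂ)) = 0 := by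
    have h2 : (R⁻¹ * R) * diagonal (fun i => (x i : ℂ)) * (R⁻¹ * R)ᴴ = 0 := by
      calc _ = R⁻¹ * congruence R x * R⁻¹ᴴ := by
            simp only [congruence, conjTranspose_mul, Matrix.mul_assoc]
        _ = 0 := by rw [h, Matrix.mul_zero, Matrix.zero_mul]
    rwa [nonsing_inv_mul R hdet, conjTranspose_one, Matrix.one_mul, Matrix.mul_one] at h2
  ext i
  have := congrFun (congrFun h1 i) i
  simpa using this

lemma Fmin_congruence {R : Op k} (hR : IsUnit R) {x y : Fin k → ℝ} (hx : ∀ i, 0 ≤ x i)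
    (hy : ∀ i, 0 ≤ y i) :
    Fmin (congruence R x) (congruence R y) = (congruenceFidelity R x y : EReal) := by
  have hX := congruence_posSemidef R hx
  have hY := congruence_posSemidef R hy
  unfold Fmin extend
  rw [if_pos ⟨hX, hY⟩]
  split_ifs with h
  · rcases h with h | h
    · simp [congruenceFidelity, eq_zero_of_congruence_eq_zero hR h]
    · simp [congruenceFidelity, eq_zero_of_congruence_eq_zero hR h]
  · push Not at h
    have hx0 := re_trace_pos hX h.1
    have hy0 := re_trace_pos hY h.2
    set a := (congruence R x).trace.re with ha
    set b := (congruence R y).trace.re with hb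
    have hab : 0 ≤ a⁻¹ * b⁻¹ := (mul_pos (inv_pos.2 hx0) (inv_pos.2 hy0)).le
    have htr : ∀ (z : Fin k → ℝ) (c : ℝ), (congruence R z).trace.re = c → 0 < c →
        (congruence R (fun i => c⁻¹ * z i)).trace.re = 1 := fun z c hz hc => by
      rw [← congruence_smul, trace_smul, smul_eq_mul, Complex.re_ofReal_mul, hz,
        inv_mul_cancel₀ hc.ne']
    rw [trace_eq_ofReal hX, trace_eq_ofReal hY, ← ha, ← hb, ← Complex.ofReal_inv,
      ← Complex.ofReal_inv, congruence_smul, congruence_smul,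
      stateFmin_congruence hR (fun i => mul_nonneg (inv_pos.2 hx0).le (hx i))
        (fun i => mul_nonneg (inv_pos.2 hy0).le (hy i)) (htr x a rfl hx0) (htr y b rfl hy0),
      congruenceFidelity_mul_mul R hab, ← mul_assoc, ← Real.sqrt_mul (mul_pos hx0 hy0).le,
      show a * b * (a⁻¹ * b⁻¹) = 1 by field_simp]
    simp

end Extension

/-! ### Support-set duality. -/

section Duality

variable {k : ℕ}

lemma re_trace_mul_nonneg {P X : Op k} (hP : P.PosSemidef) (hX : X.PosSemidef) :
    0 ≤ (P * X).trace.re := by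
  obtain ⟨M, rfl⟩ := exists_mul_conjTranspose_eq hP
  rw [Matrix.mul_assoc, trace_mul_comm]
  exact (Complex.le_def.1 (hX.conjTranspose_mul_mul_same M).trace_nonneg).1

lemma isUnit_one_sub {A : Op k} (hA : A.IsHermitian) : IsUnit (1 - Complex.I • A) := by
  have h : ((1 - Complex.I • A)ᴴ * (1 - Complex.I • A)).PosDef := by
    have h1 : (1 - Complex.I • A)ᴴ * (1 - Complex.I • A) = 1 + Aᴴ * A := by
      rw [conjTranspose_one_sub hA, hA.eq, Matrix.add_mul, Matrix.mul_sub, Matrix.mul_sub,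
        smul_mul_smul_comm, Complex.I_mul_I]
      simp [← add_assoc]
    rw [h1]
    exact PosDef.one.add_posSemidef (posSemidef_conjTranspose_mul_self A)
  have h2 := (isUnit_iff_isUnit_det _).1 h.isUnit
  rw [det_mul] at h2
  exact (isUnit_iff_isUnit_det _).2 (isUnit_of_mul_isUnit_right h2)

lemma isUnit_one_add {A : Op k} (hA : A.IsHermitian) : IsUnit (1 + Complex.I • A) := by
  have := isUnit_one_sub hA.neg
  rwa [smul_neg, sub_neg_eq_add] at this

lemma mem_supportSet_Fmax {L : Op k} (hL : L.PosDef) :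
    (L, (1 / 4 : ℂ) • L⁻¹) ∈ supportSet (Fmax (k := k)) := by
  refine ⟨hL.1, (hL.inv.posSemidef.smul (by positivity)).1, fun X Y hX hY => ?_⟩
  rw [Fmax_eq_stateFmax hX hY, EReal.coe_le_coe_iff]
  refine (stateFmax_le hX hY hL).trans_eq ?_
  dsimp only
  rw [Matrix.smul_mul, trace_smul, smul_eq_mul, show (1 / 4 : ℂ) = ((1 / 4 : ℝ) : ℂ) by push_cast; rfl,
    Complex.re_ofReal_mul]
  ring

lemma add_mem_supportSet {F : Op k → Op k → EReal} {L₀ L₁ P Q : Op k}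
    (h : (L₀, L₁) ∈ supportSet F) (hP : P.PosSemidef) (hQ : Q.PosSemidef) :
    (L₀ + P, L₁ + Q) ∈ supportSet F := by
  refine ⟨h.1.add hP.1, h.2.1.add hQ.1, fun X Y hX hY => (h.2.2 X Y hX hY).trans ?_⟩
  rw [EReal.coe_le_coe_iff]
  dsimp only
  rw [Matrix.add_mul, Matrix.add_mul, trace_add, trace_add, Complex.add_re, Complex.add_re]
  linarith [re_trace_mul_nonneg hP hX, re_trace_mul_nonneg hQ hY]

lemma mem_deformedDualValues_of_mem_supportSet {X Y L₀ L₁ : Op k}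
    (h : (L₀, L₁) ∈ supportSet (Fmax (k := k))) :
    (((X * L₀).trace.re + (Y * L₁).trace.re : ℝ) : EReal) ∈ deformedDualValues X Y := by
  refine ⟨L₀, L₁, 0, h.1, h.2.1, isHermitian_zero, ?_, rfl⟩
  simpa using h

/-- Test membership on `X` and `(1 + iA) Y (1 - iA)`: the inverse factors cancel and leave `tr Y
L₁`, while `F_max` of this pair dominates `F_min`. -/
lemma Fmin_le_of_mem_deformedDualValues {R : Op k} (hR : IsUnit R) {x y : Fin k → ℝ}
    (hx : ∀ i, 0 ≤ x i) (hy : ∀ i, 0 ≤ y i) {t : EReal}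
    (ht : t ∈ deformedDualValues (congruence R x) (congruence R y)) :
    Fmin (congruence R x) (congruence R y) ≤ t := by
  obtain ⟨L₀, L₁, A, -, -, hA, hmem, rfl⟩ := ht
  have hX := congruence_posSemidef R hx
  have hY := congruence_posSemidef R hy
  have hY' := posSemidef_deform' hY hA
  have h1 := hmem.2.2 _ _ hX hY'
  have hdet := (isUnit_iff_isUnit_det _).1 (isUnit_one_sub hA)
  have hdet' := (isUnit_iff_isUnit_det _).1 (isUnit_one_add hA)
  have htr : ((1 - Complex.I • A)⁻¹ * L₁ * (1 + Complex.I • A)⁻¹ *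
      ((1 + Complex.I • A) * congruence R y * (1 - Complex.I • A))).trace
        = (congruence R y * L₁).trace := by
    rw [show (1 - Complex.I • A)⁻¹ * L₁ * (1 + Complex.I • A)⁻¹ *
        ((1 + Complex.I • A) * congruence R y * (1 - Complex.I • A))
        = (1 - Complex.I • A)⁻¹ * (L₁ * ((1 + Complex.I • A)⁻¹ * (1 + Complex.I • A))
          * congruence R y) * (1 - Complex.I • A) by simp only [Matrix.mul_assoc],
      nonsing_inv_mul _ hdet', Matrix.mul_one, trace_mul_comm, ← Matrix.mul_assoc,
      mul_nonsing_inv _ hdet, Matrix.one_mul, trace_mul_comm]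
  dsimp only at h1
  rw [htr, trace_mul_comm L₀] at h1
  refine le_trans ?_ h1
  have h2 := congruenceFidelity_le_stateFmax R hx hy hA.neg
  rw [smul_neg, sub_neg_eq_add, ← sub_eq_add_neg] at h2
  rw [Fmin_congruence hR hx hy, Fmax_eq_stateFmax hX hY', EReal.coe_le_coe_iff]
  exact h2

/-- With `P = Mᴴ (1 - iA) N` positive definite, `L = M⁻¹ᴴ P M⁻¹ / 2` saturates the AM-GM bound: both
terms equal `tr P / 2`. -/
lemma exists_dual_optimizer {R : Op k} (hR : IsUnit R) {x y : Fin k → ℝ}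
    (hx : ∀ i, 0 < x i) (hy : ∀ i, 0 < y i) :
    ∃ L₀ L₁ A : Op k, L₀.PosSemidef ∧ L₁.PosSemidef ∧ A.IsHermitian ∧
      (L₀, (1 - Complex.I • A)⁻¹ * L₁ * (1 + Complex.I • A)⁻¹) ∈ supportSet (Fmax (k := k)) ∧
      (congruence R x * L₀).trace.re + (congruence R y * L₁).trace.re
        = congruenceFidelity R x y := by
  obtain ⟨A, hA, hP, hval, hval'⟩ :=
    exists_optimal_deformation hR (fun i => (hx i).le) (fun i => (hy i).le)
  have hMM := sqrt_factor_mul_self R (fun i => (hx i).le)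
  have hNN := sqrt_factor_mul_self R (fun i => (hy i).le)
  have hunit : ∀ z : Fin k → ℝ, (∀ i, 0 < z i) →
      IsUnit (R * diagonal (fun i => (Real.sqrt (z i) : ℂ))) := fun z hz => by
    refine hR.mul ((isUnit_iff_isUnit_det _).2 ?_)
    rw [det_diagonal, isUnit_iff_ne_zero, Finset.prod_ne_zero_iff]
    intro i _
    exact_mod_cast (Real.sqrt_pos.2 (hz i)).ne'
  have hM := hunit x hx
  have hN := hunit y hy
  set M := R * diagonal (fun i => (Real.sqrt (x i) : ℂ)) with hMdef
  set N := R * diagonal (fun i => (Real.sqrt (y i) : ℂ)) with hNdef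
  clear_value M N
  set P := Mᴴ * ((1 - Complex.I • A) * N) with hPdef
  have hMdet := (isUnit_iff_isUnit_det _).1 hM
  have hMH : IsUnit Mᴴ := hM.star
  have hPpos : P.PosDef := hP.posDef_iff_isUnit.2 (hMH.mul ((isUnit_one_sub hA).mul hN))
  have hMi : M⁻¹ * M = 1 := nonsing_inv_mul M hMdet
  have hMi' : M⁻¹ᴴ * Mᴴ = 1 := by
    rw [← conjTranspose_mul, mul_nonsing_inv M hMdet, conjTranspose_one]
  have hMi'' : Mᴴ * M⁻¹ᴴ = 1 := by rw [← conjTranspose_mul, hMi, conjTranspose_one]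
  have h2re : ∀ z : ℂ, ((1 / 2 : ℂ) * z).re = z.re / 2 := fun z => by
    rw [show (1 / 2 : ℂ) = ((1 / 2 : ℝ) : ℂ) by push_cast; rfl, Complex.re_ofReal_mul]; ring
  have hMinv : IsUnit M⁻¹ := IsUnit.of_mul_eq_one _ hMi
  set L := (1 / 2 : ℂ) • (M⁻¹ᴴ * P * M⁻¹) with hLdef
  have hL : L.PosDef :=
    (hPpos.conjTranspose_mul_mul_same (mulVec_injective_of_isUnit hMinv)).smul (by positivity)
  have hLdet := (isUnit_iff_isUnit_det _).1 hL.isUnit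
  have hsupp := mem_supportSet_Fmax hL
  have hQ : ((1 / 4 : ℂ) • L⁻¹).PosSemidef :=
    hL.inv.posSemidef.smul (by positivity)
  -- The dual formula deforms with the opposite sign, hence `-A`.
  refine ⟨L, (1 + Complex.I • A) * ((1 / 4 : ℂ) • L⁻¹) * (1 - Complex.I • A), -A, hL.posSemidef,
    posSemidef_deform' hQ hA, hA.neg, ?_, ?_⟩
  · have hdet := (isUnit_iff_isUnit_det _).1 (isUnit_one_sub hA)
    have hdet' := (isUnit_iff_isUnit_det _).1 (isUnit_one_add hA)
    rw [smul_neg, sub_neg_eq_add, ← sub_eq_add_neg,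
      show (1 + Complex.I • A)⁻¹ * ((1 + Complex.I • A) * ((1 / 4 : ℂ) • L⁻¹) *
          (1 - Complex.I • A)) * (1 - Complex.I • A)⁻¹
        = ((1 + Complex.I • A)⁻¹ * (1 + Complex.I • A)) * ((1 / 4 : ℂ) • L⁻¹) *
          ((1 - Complex.I • A) * (1 - Complex.I • A)⁻¹) by simp only [Matrix.mul_assoc],
      nonsing_inv_mul _ hdet', mul_nonsing_inv _ hdet, Matrix.one_mul, Matrix.mul_one]
    exact hsupp
  · have hXL : (congruence R x * L).trace.re = P.trace.re / 2 := by
      rw [← hMM, hLdef, Matrix.mul_smul, trace_smul, smul_eq_mul, h2re,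
        show M * Mᴴ * (M⁻¹ᴴ * P * M⁻¹) = M * ((Mᴴ * M⁻¹ᴴ) * P * M⁻¹) by
          simp only [Matrix.mul_assoc], hMi'', Matrix.one_mul, trace_mul_comm, Matrix.mul_assoc,
        hMi, Matrix.mul_one]
    have hK : (1 - Complex.I • A) * N = M⁻¹ᴴ * P := by
      rw [hPdef, ← Matrix.mul_assoc, hMi', Matrix.one_mul]
    have hKK : (1 - Complex.I • A) * congruence R y * (1 + Complex.I • A)
        = L * ((2 : ℂ) • (M * P * M⁻¹)) := by
      calc (1 - Complex.I • A) * congruence R y * (1 + Complex.I • A)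
          = ((1 - Complex.I • A) * N) * ((1 - Complex.I • A) * N)ᴴ := by
            rw [← hNN, conjTranspose_mul, conjTranspose_one_sub hA]; simp only [Matrix.mul_assoc]
        _ = M⁻¹ᴴ * P * (M⁻¹ * M) * P * M⁻¹ := by
            rw [hK, hMi, conjTranspose_mul, hP.1.eq, conjTranspose_conjTranspose]
            simp only [Matrix.mul_assoc, Matrix.one_mul]
        _ = L * ((2 : ℂ) • (M * P * M⁻¹)) := by
            rw [hLdef, Matrix.smul_mul, Matrix.mul_smul, smul_smul]
            norm_num
            simp only [Matrix.mul_assoc]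
    have hYL : (congruence R y * ((1 + Complex.I • A) * ((1 / 4 : ℂ) • L⁻¹) *
        (1 - Complex.I • A))).trace.re = P.trace.re / 2 := by
      rw [trace_mul_comm, show (1 + Complex.I • A) * ((1 / 4 : ℂ) • L⁻¹) * (1 - Complex.I • A)
          * congruence R y = (1 + Complex.I • A) * (((1 / 4 : ℂ) • L⁻¹) *
            ((1 - Complex.I • A) * congruence R y)) by simp only [Matrix.mul_assoc],
        trace_mul_comm, Matrix.mul_assoc, hKK, Matrix.smul_mul, ← Matrix.mul_assoc,
        nonsing_inv_mul _ hLdet, Matrix.one_mul, smul_smul, trace_smul,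
        trace_mul_comm (M * P), ← Matrix.mul_assoc, hMi, Matrix.one_mul, smul_eq_mul,
        show (1 / 4 * 2 : ℂ) = 1 / 2 by norm_num, h2re]
    rw [hXL, hYL, ← hval', hval]
    ring

lemma congruence_add (R : Op k) (x y : Fin k → ℝ) :
    congruence R (fun i => x i + y i) = congruence R x + congruence R y := by
  simp only [congruence]
  rw [← Matrix.add_mul, ← Matrix.mul_add, diagonal_add]
  congr 3; ext i; simp

lemma pos_of_posDef_congruence {R : Op k} (hR : IsUnit R) {x : Fin k → ℝ}
    (h : (congruence R x).PosDef) (i : Fin k) : 0 < x i := by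
  have h1 := (IsUnit.posDef_star_right_conjugate_iff hR).1 h
  exact_mod_cast posDef_diagonal_iff.1 h1 i

/-- Raising `x` and `y` by `ε` gives positive definite operators with the same `R`. Their optimisers
are positive semidefinite, so their value at the original pair is no larger; let `ε → 0`. -/
lemma isGLB_deformedDualValues_congruence {R : Op k} (hR : IsUnit R) {x y : Fin k → ℝ}
    (hx : ∀ i, 0 ≤ x i) (hy : ∀ i, 0 ≤ y i) :
    IsGLB (deformedDualValues (congruence R x) (congruence R y))
      (Fmin (congruence R x) (congruence R y)) := by
  refine ⟨fun t ht => Fmin_le_of_mem_deformedDualValues hR hx hy ht, fun b hb => ?_⟩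
  have hle : ∀ ε : ℝ, 0 < ε →
      b ≤ (congruenceFidelity R (fun i => x i + ε) (fun i => y i + ε) : EReal) := fun ε hε => by
    obtain ⟨L₀, L₁, A, hL₀, hL₁, hA, hmem, hval⟩ := exists_dual_optimizer hR
      (fun i => add_pos_of_nonneg_of_pos (hx i) hε) (fun i => add_pos_of_nonneg_of_pos (hy i) hε)
    refine (hb ⟨L₀, L₁, A, hL₀.1, hL₁.1, hA, hmem, rfl⟩).trans ?_
    have hE := congruence_posSemidef R (fun _ : Fin k => hε.le)
    rw [EReal.coe_le_coe_iff, ← hval, congruence_add, congruence_add, Matrix.add_mul,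
      Matrix.add_mul, trace_add, trace_add, Complex.add_re, Complex.add_re]
    linarith [re_trace_mul_nonneg hE hL₀, re_trace_mul_nonneg hE hL₁]
  have hcont : Continuous fun ε : ℝ =>
      congruenceFidelity R (fun i => x i + ε) (fun i => y i + ε) := by
    unfold congruenceFidelity
    fun_prop
  have hlim := (continuous_coe_real_ereal.comp hcont).continuousWithinAt (s := Set.Ioi 0) (x := 0)
  rw [Fmin_congruence hR hx hy]
  have h0 : (congruenceFidelity R x y : EReal) = ((fun r : ℝ => (r : EReal)) ∘ fun ε : ℝ =>
      congruenceFidelity R (fun i => x i + ε) (fun i => y i + ε)) 0 := by simp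
  rw [h0]
  exact ge_of_tendsto hlim (Filter.eventually_of_mem self_mem_nhdsWithin fun ε hε => hle ε hε)

lemma isGLB_bot_of_forall_mem {S : Set EReal} {a c : ℝ} (hc : c < 0)
    (h : ∀ s : ℝ, 0 ≤ s → ((a + s * c : ℝ) : EReal) ∈ S) : IsGLB S ⊥ := by
  refine ⟨fun _ _ => bot_le, fun b hb => ?_⟩
  rw [le_bot_iff, EReal.eq_bot_iff_forall_lt]
  intro y
  refine (hb (h ((|a - y| + 1) / -c)
    (div_nonneg (by positivity) (neg_pos.2 hc).le))).trans_lt ?_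
  rw [EReal.coe_lt_coe_iff, div_mul_eq_mul_div, div_neg, mul_div_cancel_right₀ _ hc.ne]
  linarith [le_abs_self (a - y)]

lemma exists_re_dotProduct_neg {X : Op k} (hX : X.IsHermitian) (h : ¬ X.PosSemidef) :
    ∃ v : Fin k → ℂ, (star v ⬝ᵥ (X *ᵥ v)).re < 0 := by
  by_contra hcon
  push Not at hcon
  refine h (PosSemidef.of_dotProduct_mulVec_nonneg hX fun v => Complex.le_def.2 ⟨hcon v, ?_⟩)
  exact (hX.im_star_dotProduct_mulVec_self v).symm

lemma re_trace_mul_one_add (X : Op k) (v : Fin k → ℂ) (s : ℝ) :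
    (X * (1 + (s : ℂ) • vecMulVec v (star v))).trace.re
      = X.trace.re + s * (star v ⬝ᵥ (X *ᵥ v)).re := by
  rw [Matrix.mul_add, Matrix.mul_one, Matrix.mul_smul, mul_vecMulVec, trace_add, trace_smul,
    trace_vecMulVec, smul_eq_mul, Complex.add_re, Complex.re_ofReal_mul, dotProduct_comm]

/-- The support set is stable under adding `s v vᴴ` to either entry; a direction `v` where `X` or
`Y` is negative drives the value to `-∞`. -/
lemma isGLB_deformedDualValues_bot {X Y : Op k} (hX : X.IsHermitian) (hY : Y.IsHermitian)
    (h : ¬ (X.PosSemidef ∧ Y.PosSemidef)) : IsGLB (deformedDualValues X Y) ⊥ := by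
  have hbase : ((1 : Op k), (1 : Op k)) ∈ supportSet (Fmax (k := k)) := by
    have h1 := add_mem_supportSet (mem_supportSet_Fmax (PosDef.one (n := Fin k) (R := ℂ)))
      PosSemidef.zero (P := 0) (Q := (3 / 4 : ℂ) • 1) (PosSemidef.one.smul (by positivity))
    rw [inv_one, ← add_smul, add_zero] at h1
    norm_num at h1
    exact h1
  have hpsd : ∀ (v : Fin k → ℂ) (s : ℝ), 0 ≤ s → ((s : ℂ) • vecMulVec v (star v)).PosSemidef :=
    fun v s hs => (posSemidef_vecMulVec_self_star v).smul (by exact_mod_cast hs)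
  by_cases hXp : X.PosSemidef
  · obtain ⟨v, hv⟩ := exists_re_dotProduct_neg hY fun hYp => h ⟨hXp, hYp⟩
    refine isGLB_bot_of_forall_mem (a := X.trace.re + Y.trace.re) hv fun s hs => ?_
    have := mem_deformedDualValues_of_mem_supportSet (X := X) (Y := Y)
      (add_mem_supportSet hbase PosSemidef.zero (hpsd v s hs))
    rwa [re_trace_mul_one_add, add_zero, Matrix.mul_one, ← add_assoc] at this
  · obtain ⟨v, hv⟩ := exists_re_dotProduct_neg hX hXp
    refine isGLB_bot_of_forall_mem (a := X.trace.re + Y.trace.re) hv fun s hs => ?_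
    have := mem_deformedDualValues_of_mem_supportSet (X := X) (Y := Y)
      (add_mem_supportSet hbase (hpsd v s hs) PosSemidef.zero)
    rwa [re_trace_mul_one_add, add_zero, Matrix.mul_one, add_right_comm] at this

end Duality

end Fidelity

theorem mainTheorem9 (k : ℕ) (X Y : Fidelity.Op k) (hX : X.IsHermitian) (hY : Y.IsHermitian) :
    IsGLB (Fidelity.deformedDualValues X Y) (Fidelity.Fmin X Y) ∧
    (X.PosDef → Y.PosDef →
      IsLeast (Fidelity.deformedDualValues X Y) (Fidelity.Fmin X Y)) ∧
    IsLeast {t : EReal | ∃ A : Fidelity.Op k, A.IsHermitian ∧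
        t = Fidelity.Fmax X ((1 - Complex.I • A) * Y * (1 + Complex.I • A))}
      (Fidelity.Fmin X Y) ∧
    IsLeast {t : EReal | ∃ A : Fidelity.Op k, A.IsHermitian ∧
        t = Fidelity.Fmax ((1 + Complex.I • A) * X * (1 - Complex.I • A)) Y}
      (Fidelity.Fmin X Y) := by
  by_cases h : X.PosSemidef ∧ Y.PosSemidef
  · obtain ⟨hXp, hYp⟩ := h
    obtain ⟨R, x, y, hR, hx, hy, hXR, hYR⟩ := Fidelity.exists_simultaneous_congruence hXp hYp
    change X = Fidelity.congruence R x at hXR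
    change Y = Fidelity.congruence R y at hYR
    have hleast : IsLeast {t : EReal | ∃ A : Fidelity.Op k, A.IsHermitian ∧
        t = Fidelity.Fmax X ((1 - Complex.I • A) * Y * (1 + Complex.I • A))}
        (Fidelity.Fmin X Y) := by
      subst hXR hYR
      rw [Fidelity.Fmin_congruence hR hx hy]
      refine ⟨?_, ?_⟩
      · obtain ⟨A, hA, -, -, hval⟩ := Fidelity.exists_optimal_deformation hR hx hy
        exact ⟨A, hA, by
          rw [Fidelity.Fmax_eq_stateFmax hXp (Fidelity.posSemidef_deform hYp hA), hval]⟩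
      · rintro t ⟨A, hA, rfl⟩
        rw [Fidelity.Fmax_eq_stateFmax hXp (Fidelity.posSemidef_deform hYp hA),
          EReal.coe_le_coe_iff]
        exact Fidelity.congruenceFidelity_le_stateFmax R hx hy hA
    have hglb : IsGLB (Fidelity.deformedDualValues X Y) (Fidelity.Fmin X Y) := by
      subst hXR hYR
      exact Fidelity.isGLB_deformedDualValues_congruence hR hx hy
    refine ⟨hglb, fun hXd hYd => ⟨?_, hglb.1⟩, hleast, ?_⟩
    · subst hXR hYR
      obtain ⟨L₀, L₁, A, hL₀, hL₁, hA, hmem, hval⟩ := Fidelity.exists_dual_optimizer hR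
        (Fidelity.pos_of_posDef_congruence hR hXd) (Fidelity.pos_of_posDef_congruence hR hYd)
      refine ⟨L₀, L₁, A, hL₀.1, hL₁.1, hA, hmem, ?_⟩
      rw [Fidelity.Fmin_congruence hR hx hy, hval]
    -- The two deformed fidelities agree for each `A`, by cyclicity of the product spectrum.
    · convert hleast using 1
      ext t
      refine exists_congr fun A => and_congr_right fun hA => ?_
      rw [Fidelity.Fmax_eq_stateFmax hXp (Fidelity.posSemidef_deform hYp hA),
        Fidelity.Fmax_eq_stateFmax (Fidelity.posSemidef_deform' hXp hA) hYp,
        Fidelity.stateFmax_deform_comm hXp hYp hA]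
  · have hmin : Fidelity.Fmin X Y = ⊥ := Fidelity.extend_of_not h
    have hmax : Fidelity.Fmax X Y = ⊥ := Fidelity.extend_of_not h
    rw [hmin]
    refine ⟨Fidelity.isGLB_deformedDualValues_bot hX hY h,
      fun hXd hYd => (h ⟨hXd.posSemidef, hYd.posSemidef⟩).elim,
      ⟨⟨0, Matrix.isHermitian_zero, ?_⟩, fun _ _ => bot_le⟩,
      ⟨⟨0, Matrix.isHermitian_zero, ?_⟩, fun _ _ => bot_le⟩⟩
    · simp [hmax]
    · simp [hmax]
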